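/- Let $X$ be a complex Banach space and let $T=(T(t))_{t\ge 0}$ be a $C_0$-semigroup of bounded linear operators on $X$ with infinitesimal generator $A\colon D(A)\subset X\to X$, that is, $D(A)$ is the set of all $x\in X$ for which the limit $Ax=\lim_{h\to 0^+}h^{-1}(T(h)x-x)$ exists. Write $\rho(A)$ for the resolvent set of $A$, that is, the set of all $\lambda\in\mathbb{C}$ for which $A-\lambda I\colon D(A)\to X$ has a bounded inverse $R(\lambda,A)=(A-\lambda I)^{-1}$ defined on all of $X$. If $T$ is hyperbolic, that is, $\sigma(T(1))\cap\{z\in\mathbb{C}:|z|=1\}=\emptyset$, then $$i\mathbb{R}\subset\rho(A)\qquad\text{and}\qquad \sup_{\lambda\in i\mathbb{R}}\|R(\lambda,A)\|<\infty .$$ -/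

import Mathlib

open Set Filter Topology
open scoped NNReal

/-- A `C₀`-semigroup (strongly continuous one-parameter semigroup) of bounded linear operators
on a complex normed space `X`, indexed by `t ∈ [0, ∞)`. -/
structure C0Semigroup (X : Type*) [NormedAddCommGroup X] [NormedSpace ℂ X] where
  /-- The operators `T(t)` of the semigroup. -/
  toFun : ℝ≥0 → X →L[ℂ] X
  map_zero' : toFun 0 = 1
  map_add' : ∀ s t : ℝ≥0, toFun (s + t) = toFun s * toFun t
  continuous_orbit' : ∀ x : X, Continuous fun t : ℝ≥0 => toFun t x

namespace C0Semigroup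

variable {X : Type*} [NormedAddCommGroup X] [NormedSpace ℂ X]

instance : CoeFun (C0Semigroup X) (fun _ => ℝ≥0 → X →L[ℂ] X) := ⟨C0Semigroup.toFun⟩

/-- The semigroup is hyperbolic: the spectrum of `T(1)` does not meet the unit circle. -/
def IsHyperbolic (T : C0Semigroup X) : Prop :=
  spectrum ℂ (T 1) ∩ {z : ℂ | ‖z‖ = 1} = ∅

/-- `y` is the limit of `h⁻¹ (T(h) x - x)` as `h → 0`, `h > 0`. -/
def HasGenerator (T : C0Semigroup X) (x y : X) : Prop :=
  Tendsto (fun h : ℝ≥0 => ((h : ℝ) : ℂ)⁻¹ • (T h x - x)) (𝓝[>] 0) (𝓝 y)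

theorem HasGenerator.add {T : C0Semigroup X} {x y x' y' : X}
    (h : T.HasGenerator x y) (h' : T.HasGenerator x' y') : T.HasGenerator (x + x') (y + y') := by
  refine (Tendsto.add h h').congr fun t => ?_
  rw [← smul_add, map_add]
  congr 1
  abel

theorem HasGenerator.smul {T : C0Semigroup X} {x y : X} (c : ℂ)
    (h : T.HasGenerator x y) : T.HasGenerator (c • x) (c • y) := by
  refine (Tendsto.const_smul h c).congr fun t => ?_
  rw [map_smul, ← smul_sub, smul_comm]

theorem HasGenerator.zero (T : C0Semigroup X) : T.HasGenerator 0 0 := by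
  simp [HasGenerator]

theorem HasGenerator.unique {T : C0Semigroup X} {x y y' : X}
    (h : T.HasGenerator x y) (h' : T.HasGenerator x y') : y = y' :=
  tendsto_nhds_unique h h'

/-- The infinitesimal generator `A : D(A) ⊆ X → X` of the semigroup: `D(A)` is the set of all `x`
for which the limit of `h⁻¹ (T(h) x - x)` as `h → 0+` exists, and `A x` is that limit. -/
noncomputable def generator (T : C0Semigroup X) : X →ₗ.[ℂ] X where
  domain :=
    { carrier := {x | ∃ y, T.HasGenerator x y}
      add_mem' := fun ⟨_, h⟩ ⟨_, h'⟩ => ⟨_, h.add h'⟩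
      zero_mem' := ⟨0, HasGenerator.zero T⟩
      smul_mem' := fun c _ ⟨_, h⟩ => ⟨_, h.smul c⟩ }
  toFun :=
    { toFun := fun x => Classical.choose x.2
      map_add' := fun x x' =>
        (Classical.choose_spec (x + x').2).unique
          ((Classical.choose_spec x.2).add (Classical.choose_spec x'.2))
      map_smul' := fun c x =>
        (Classical.choose_spec (c • x).2).unique ((Classical.choose_spec x.2).smul c) }

theorem mem_generator_domain_iff (T : C0Semigroup X) (x : X) :
    x ∈ T.generator.domain ↔ ∃ y, T.HasGenerator x y := Iff.rfl

theorem hasGenerator_generator (T : C0Semigroup X) (x : T.generator.domain) :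
    T.HasGenerator x (T.generator x) := Classical.choose_spec x.2

end C0Semigroup

namespace UnboundedOperator

variable {X : Type*} [NormedAddCommGroup X] [NormedSpace ℂ X]

/-- The everywhere defined bounded operator `R` is the inverse of `A - z I : D(A) → X`. -/
structure IsInverseSub (A : X →ₗ.[ℂ] X) (z : ℂ) (R : X →L[ℂ] X) : Prop where
  mem_domain : ∀ y : X, R y ∈ A.domain
  right_inv : ∀ y : X, A ⟨R y, mem_domain y⟩ - z • R y = y
  left_inv : ∀ x : A.domain, R (A x - z • (x : X)) = x

/-- The resolvent set `ρ(A)`: all `z` for which `A - z I : D(A) → X` has a bounded inverse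
defined on the whole of `X`. -/
def resolventSet (A : X →ₗ.[ℂ] X) : Set ℂ :=
  {z | ∃ R : X →L[ℂ] X, IsInverseSub A z R}

open Classical in
/-- The resolvent operator `R(z, A) = (A - z I)⁻¹` for `z ∈ ρ(A)`
(with the value `0` elsewhere). -/
noncomputable def resolvent (A : X →ₗ.[ℂ] X) (z : ℂ) : X →L[ℂ] X :=
  if h : z ∈ resolventSet A then Classical.choose h else 0

theorem IsInverseSub.unique {A : X →ₗ.[ℂ] X} {z : ℂ} {R S : X →L[ℂ] X}
    (hR : IsInverseSub A z R) (hS : IsInverseSub A z S) : R = S := by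
  ext y
  have h := hR.left_inv ⟨S y, hS.mem_domain y⟩
  rwa [hS.right_inv y] at h

theorem isInverseSub_resolvent {A : X →ₗ.[ℂ] X} {z : ℂ} (h : z ∈ resolventSet A) :
    IsInverseSub A z (resolvent A z) := by
  rw [resolvent, dif_pos h]
  exact Classical.choose_spec h

end UnboundedOperator

/-!
The semigroup `e^{-zt} T(t)` has generator `A - z`, so inverting `A - z` reduces to inverting a
generator `B` of a semigroup `S`. With `V(t) = ∫₀ᵗ S(s) ds`, the identities
`B V(t) x = S(t) x - x` and `V(t) B x = S(t) x - x` show that `-V(t) (1 - S(t))⁻¹` inverts `B` as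
soon as `1 ∉ σ(S(t))`. For `S(t) = e^{-zt} T(t)` this says that `e^{zt} ∉ σ(T(t))` implies
`z ∈ ρ(A)`. On a vertical line `Re z = a` the operators `V(t)` are uniformly bounded, since
`‖S(s)‖` depends on `z` only through `a`, while `(1 - S(t))⁻¹` is controlled by the resolvent of
`T(t)` on the compact circle of radius `e^{at}`.
-/

theorem tendsto_inv_smul_sub_of_hasDerivAt {E : Type*} [NormedAddCommGroup E] [NormedSpace ℂ E]
    {f : ℝ → E} {f' : E} {a : ℝ} (hf : HasDerivAt f f' a) :
    Tendsto (fun h : ℝ≥0 => ((h : ℝ) : ℂ)⁻¹ • (f (a + h) - f a)) (𝓝[>] 0) (𝓝 f') := by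
  have hcoe : Tendsto ((↑) : ℝ≥0 → ℝ) (𝓝[>] 0) (𝓝[>] 0) :=
    tendsto_nhdsWithin_iff.2 ⟨(NNReal.continuous_coe.tendsto' 0 0 rfl).mono_left nhdsWithin_le_nhds,
      eventually_mem_nhdsWithin.mono fun _ => NNReal.coe_pos.2⟩
  refine (hf.tendsto_slope_zero_right.comp hcoe).congr fun h => ?_
  rw [Function.comp_apply, ← Complex.ofReal_inv, Complex.coe_smul]

theorem exists_norm_resolvent_le {𝕜 A : Type*} [NontriviallyNormedField 𝕜] [NormedRing A]
    [NormedAlgebra 𝕜 A] [CompleteSpace A] {a : A} {K : Set 𝕜} (hK : IsCompact K)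
    (hKa : K ⊆ resolventSet 𝕜 a) : ∃ C, ∀ w ∈ K, ‖resolvent a w‖ ≤ C :=
  hK.exists_bound_of_continuousOn fun _ hw =>
    (spectrum.hasDerivAt_resolvent_const_left (hKa hw)).continuousAt.continuousWithinAt

theorem commute_resolvent {R A : Type*} [CommRing R] [Ring A] [Algebra R A] {a b : A}
    (h : Commute a b) (r : R) : Commute (resolvent a r) b := by
  have hsub : Commute (algebraMap R A r - a) b := Commute.sub_left (Algebra.commutes r b) h
  rw [resolvent]
  by_cases hu : IsUnit (algebraMap R A r - a)
  · obtain ⟨u, hu⟩ := hu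
    rw [← hu] at hsub ⊢
    rw [Ring.inverse_unit]
    exact hsub.units_inv_left
  · rw [Ring.inverse_non_unit _ hu]
    exact Commute.zero_left b

namespace UnboundedOperator

theorem IsInverseSub.resolvent_eq {X : Type*} [NormedAddCommGroup X] [NormedSpace ℂ X]
    {A : X →ₗ.[ℂ] X} {z : ℂ} {R : X →L[ℂ] X} (hR : IsInverseSub A z R) : resolvent A z = R :=
  (isInverseSub_resolvent ⟨R, hR⟩).unique hR

end UnboundedOperator

namespace C0Semigroup

open UnboundedOperator (IsInverseSub)

variable {X : Type*} [NormedAddCommGroup X] [NormedSpace ℂ X]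

theorem HasGenerator.map {T : C0Semigroup X} {x y : X} (h : T.HasGenerator x y) {L : X →L[ℂ] X}
    (hL : ∀ t, Commute (T t) L) : T.HasGenerator (L x) (L y) := by
  refine ((L.continuous.tendsto y).comp h).congr fun t => ?_
  have hLx : T t (L x) = L (T t x) := congr($((hL t).eq) x)
  rw [Function.comp_apply, map_smul, map_sub, hLx]

theorem isInverseSub_generator_iff {T : C0Semigroup X} {z : ℂ} {R : X →L[ℂ] X} :
    IsInverseSub T.generator z R ↔
      (∀ y, T.HasGenerator (R y) (y + z • R y)) ∧
        ∀ x y, T.HasGenerator x y → R (y - z • x) = x := by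
  constructor
  · refine fun hR => ⟨fun y => ?_, fun x y hxy => ?_⟩
    · rw [← sub_eq_iff_eq_add.1 (hR.right_inv y)]
      exact T.hasGenerator_generator _
    · have hAx := (T.hasGenerator_generator ⟨x, y, hxy⟩).unique hxy
      simpa only [hAx] using hR.left_inv ⟨x, y, hxy⟩
  · rintro ⟨hright, hleft⟩
    refine ⟨fun y => ⟨_, hright y⟩, fun y => ?_, fun x => hleft x _ (T.hasGenerator_generator x)⟩
    exact sub_eq_iff_eq_add.2 ((T.hasGenerator_generator _).unique (hright y))

/-- The rescaled semigroup `t ↦ e^{-zt} T(t)`, whose generator is `A - z`. It reduces statements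
about `A - z` to statements about a generator itself. -/
noncomputable def rescale (T : C0Semigroup X) (z : ℂ) : C0Semigroup X where
  toFun t := Complex.exp (-z * (t : ℝ)) • T t
  map_zero' := by simp [T.map_zero']
  map_add' s t := by
    rw [T.map_add', smul_mul_smul_comm, ← Complex.exp_add]
    push_cast
    ring_nf
  continuous_orbit' x := Continuous.smul (by fun_prop) (T.continuous_orbit' x)

theorem rescale_apply (T : C0Semigroup X) (z : ℂ) (t : ℝ≥0) :
    T.rescale z t = Complex.exp (-z * (t : ℝ)) • T t := rfl

theorem norm_rescale_apply (T : C0Semigroup X) (z : ℂ) (t : ℝ≥0) :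
    ‖T.rescale z t‖ = Real.exp (-z.re * t) * ‖T t‖ := by
  rw [rescale_apply, norm_smul, Complex.norm_exp, Complex.re_mul_ofReal, Complex.neg_re]

theorem rescale_rescale_neg (T : C0Semigroup X) (z : ℂ) : (T.rescale z).rescale (-z) = T := by
  have htoFun : ((T.rescale z).rescale (-z)).toFun = T.toFun := by
    ext1 t
    rw [rescale_apply, rescale_apply, smul_smul, ← Complex.exp_add, neg_neg, neg_mul,
      add_neg_cancel, Complex.exp_zero, one_smul]
  cases T
  simpa only [rescale, mk.injEq] using htoFun

theorem HasGenerator.rescale {T : C0Semigroup X} {x y : X} (h : T.HasGenerator x y) (z : ℂ) :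
    (T.rescale z).HasGenerator x (y - z • x) := by
  have hderiv : HasDerivAt (fun t : ℝ => Complex.exp (-z * t)) (-z) 0 := by
    simpa using ((Complex.ofRealCLM.hasDerivAt (x := 0)).const_mul (-z)).cexp
  have hexp : Tendsto (fun t : ℝ≥0 => Complex.exp (-z * (t : ℝ))) (𝓝[>] 0) (𝓝 1) :=
    (Continuous.tendsto' (by fun_prop) 0 1 (by simp)).mono_left nhdsWithin_le_nhds
  have hlim := (hexp.smul h).add ((tendsto_inv_smul_sub_of_hasDerivAt hderiv).smul_const x)
  rw [one_smul, neg_smul, ← sub_eq_add_neg] at hlim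
  refine hlim.congr fun t => ?_
  simp only [rescale_apply, smul_apply, zero_add, Complex.ofReal_zero, mul_zero, Complex.exp_zero,
    smul_eq_mul]
  module

theorem hasGenerator_rescale_iff {T : C0Semigroup X} {z : ℂ} {x y : X} :
    (T.rescale z).HasGenerator x y ↔ T.HasGenerator x (y + z • x) := by
  refine ⟨fun h => ?_, fun h => by simpa only [add_sub_cancel_right] using h.rescale z⟩
  simpa only [rescale_rescale_neg, neg_smul, sub_neg_eq_add] using h.rescale (-z)

theorem isInverseSub_generator_rescale_iff {T : C0Semigroup X} {z w : ℂ} {R : X →L[ℂ] X} :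
    IsInverseSub (T.rescale z).generator w R ↔ IsInverseSub T.generator (w + z) R := by
  simp only [isInverseSub_generator_iff, hasGenerator_rescale_iff, add_smul, ← add_assoc]
  refine and_congr_right fun _ => forall_congr' fun x => ⟨fun h y hxy => ?_, fun h y hxy => ?_⟩
  · rw [add_comm, ← sub_sub]
    exact h (y - z • x) (by rwa [sub_add_cancel])
  · simpa only [add_sub_add_right_eq_sub] using h (y + z • x) hxy

theorem continuous_toNNReal_orbit (T : C0Semigroup X) (x : X) :
    Continuous fun s : ℝ => T s.toNNReal x :=
  (T.continuous_orbit' x).comp continuous_real_toNNReal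

theorem norm_integral_orbit_le (T : C0Semigroup X) {t : ℝ≥0} {M : ℝ} (hM : ∀ s ≤ t, ‖T s‖ ≤ M)
    (x : X) : ‖∫ s in (0 : ℝ)..t, T s.toNNReal x‖ ≤ M * t * ‖x‖ := by
  have hle : ∀ s ∈ uIoc (0 : ℝ) t, ‖T s.toNNReal x‖ ≤ M * ‖x‖ := fun s hs =>
    (T s.toNNReal).le_of_opNorm_le
      (hM _ (Real.toNNReal_le_iff_le_coe.2 (by simpa using hs.2))) x
  have hint := intervalIntegral.norm_integral_le_of_norm_le_const hle
  rwa [sub_zero, NNReal.abs_eq, mul_right_comm] at hint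

variable [CompleteSpace X]

theorem exists_norm_le (T : C0Semigroup X) (t : ℝ≥0) : ∃ M, ∀ s ≤ t, ‖T s‖ ≤ M := by
  obtain ⟨M, hM⟩ := banach_steinhaus (g := fun s : Icc 0 t => T s) fun x => by
    obtain ⟨C, hC⟩ := (isCompact_Icc (a := 0) (b := t)).exists_bound_of_continuousOn
      (T.continuous_orbit' x).continuousOn
    exact ⟨C, fun s => hC s s.2⟩
  exact ⟨M, fun s hs => hM ⟨s, zero_le, hs⟩⟩

/-- The once integrated semigroup `x ↦ ∫₀ᵗ T(s) x ds`. The integral is taken pointwise because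
`s ↦ T(s)` is in general only strongly continuous. -/
noncomputable def integratedSemigroup (T : C0Semigroup X) (t : ℝ≥0) : X →L[ℂ] X :=
  LinearMap.mkContinuousOfExistsBound
    { toFun := fun x => ∫ s in (0 : ℝ)..t, T s.toNNReal x
      map_add' := fun x y => by
        simp only [map_add]
        exact intervalIntegral.integral_add
          ((T.continuous_toNNReal_orbit x).intervalIntegrable _ _)
          ((T.continuous_toNNReal_orbit y).intervalIntegrable _ _)
      map_smul' := fun c x => by
        simp only [map_smul, intervalIntegral.integral_smul, RingHom.id_apply] }
    (let ⟨M, hM⟩ := T.exists_norm_le t; ⟨M * t, T.norm_integral_orbit_le hM⟩)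

theorem integratedSemigroup_apply (T : C0Semigroup X) (t : ℝ≥0) (x : X) :
    T.integratedSemigroup t x = ∫ s in (0 : ℝ)..t, T s.toNNReal x := rfl

theorem norm_integratedSemigroup_le (T : C0Semigroup X) {t : ℝ≥0} {M : ℝ}
    (hM : ∀ s ≤ t, ‖T s‖ ≤ M) : ‖T.integratedSemigroup t‖ ≤ M * t :=
  ContinuousLinearMap.opNorm_le_bound _
    (mul_nonneg ((norm_nonneg _).trans (hM t le_rfl)) t.coe_nonneg) (T.norm_integral_orbit_le hM)

theorem commute_integratedSemigroup (T : C0Semigroup X) (s t : ℝ≥0) :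
    Commute (T s) (T.integratedSemigroup t) := by
  ext x
  rw [mul_apply_eq_comp, mul_apply_eq_comp, integratedSemigroup_apply, integratedSemigroup_apply,
    ← ContinuousLinearMap.intervalIntegral_comp_comm _
      ((T.continuous_toNNReal_orbit x).intervalIntegrable _ _)]
  simp only [← mul_apply_eq_comp, ← T.map_add', add_comm]

theorem integratedSemigroup_add_apply (T : C0Semigroup X) (s t : ℝ≥0) (x : X) :
    T.integratedSemigroup (s + t) x =
      T.integratedSemigroup s x + T s (T.integratedSemigroup t x) := by
  have hi (a b : ℝ) : IntervalIntegrable (fun r : ℝ => T r.toNNReal x) MeasureTheory.volume a b :=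
    (T.continuous_toNNReal_orbit x).intervalIntegrable a b
  have hshift : T s (T.integratedSemigroup t x) = ∫ r in (s : ℝ)..s + t, T r.toNNReal x := by
    calc T s (T.integratedSemigroup t x)
        = ∫ r in (0 : ℝ)..t, T s (T r.toNNReal x) :=
          ((T s).intervalIntegral_comp_comm (hi 0 t)).symm
      _ = ∫ r in (0 : ℝ)..t, T (s + r).toNNReal x := by
          refine intervalIntegral.integral_congr fun r hr => ?_
          rw [uIcc_of_le t.coe_nonneg] at hr
          simp only [Real.toNNReal_add s.coe_nonneg hr.1, Real.toNNReal_coe, T.map_add',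
            mul_apply_eq_comp]
      _ = ∫ r in (s : ℝ)..s + t, T r.toNNReal x := by
          rw [intervalIntegral.integral_comp_add_left (fun r => T r.toNNReal x), add_zero]
  rw [hshift, integratedSemigroup_apply, integratedSemigroup_apply, NNReal.coe_add,
    intervalIntegral.integral_add_adjacent_intervals (hi _ _) (hi _ _)]

theorem tendsto_inv_smul_integratedSemigroup_sub (T : C0Semigroup X) (t : ℝ≥0) (x : X) :
    Tendsto (fun h : ℝ≥0 => ((h : ℝ) : ℂ)⁻¹ •
      (T.integratedSemigroup (t + h) x - T.integratedSemigroup t x)) (𝓝[>] 0) (𝓝 (T t x)) := by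
  have hderiv := (T.continuous_toNNReal_orbit x).integral_hasStrictDerivAt 0 t
  simpa only [Real.toNNReal_coe, integratedSemigroup_apply, NNReal.coe_add]
    using tendsto_inv_smul_sub_of_hasDerivAt hderiv.hasDerivAt

theorem hasGenerator_integratedSemigroup (T : C0Semigroup X) (t : ℝ≥0) (x : X) :
    T.HasGenerator (T.integratedSemigroup t x) (T t x - x) := by
  have hlim := (T.tendsto_inv_smul_integratedSemigroup_sub t x).sub
    (T.tendsto_inv_smul_integratedSemigroup_sub 0 x)
  rw [T.map_zero', one_apply_eq_self] at hlim
  refine hlim.congr fun h => ?_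
  have hzero : T.integratedSemigroup 0 x = 0 := by simp [integratedSemigroup_apply]
  rw [← smul_sub, zero_add, hzero, sub_zero, add_comm t h, integratedSemigroup_add_apply]
  congr 1
  abel

theorem HasGenerator.integratedSemigroup_apply_eq {T : C0Semigroup X} {x y : X}
    (h : T.HasGenerator x y) (t : ℝ≥0) : T.integratedSemigroup t y = T t x - x :=
  (h.map fun s => T.commute_integratedSemigroup s t).unique (T.hasGenerator_integratedSemigroup t x)

theorem isInverseSub_generator_zero_of_one_mem (T : C0Semigroup X) {t : ℝ≥0}
    (ht : 1 ∈ resolventSet ℂ (T t)) :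
    IsInverseSub T.generator 0 (-(T.integratedSemigroup t * resolvent (T t) (1 : ℂ))) := by
  set V := T.integratedSemigroup t
  set Q := resolvent (T t) (1 : ℂ) with hQ
  rw [spectrum.mem_resolventSet_iff, map_one] at ht
  have hQ_eq : Q = Ring.inverse (1 - T t) := by rw [hQ, resolvent, map_one]
  have hright (y : X) : Q y - T t (Q y) = y := by
    simpa [hQ_eq] using congr($(Ring.mul_inverse_cancel _ ht) y)
  have hleft (x : X) : Q x - Q (T t x) = x := by
    simpa [hQ_eq] using congr($(Ring.inverse_mul_cancel _ ht) x)
  have hQV : Commute Q V := commute_resolvent (T.commute_integratedSemigroup t t) 1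
  refine isInverseSub_generator_iff.2 ⟨fun y => ?_, fun x y hxy => ?_⟩
  · have hgen := (T.hasGenerator_integratedSemigroup t (Q y)).smul (-1)
    rw [neg_one_smul, neg_one_smul, neg_sub, hright] at hgen
    rwa [zero_smul, add_zero]
  · calc (-(V * Q)) (y - (0 : ℂ) • x) = -(Q (V y)) := by
          rw [← hQV.eq, zero_smul, sub_zero, neg_apply, mul_apply_eq_comp]
      _ = Q x - Q (T t x) := by rw [hxy.integratedSemigroup_apply_eq t, map_sub, neg_sub]
      _ = x := hleft x

theorem isInverseSub_generator_of_exp_mem (T : C0Semigroup X) {t : ℝ≥0} {z : ℂ}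
    (hz : Complex.exp (z * (t : ℝ)) ∈ resolventSet ℂ (T t)) :
    IsInverseSub T.generator z
      (-((T.rescale z).integratedSemigroup t *
        Complex.exp (z * (t : ℝ)) • resolvent (T t) (Complex.exp (z * (t : ℝ))))) := by
  let u : ℂˣ := Units.mk0 (Complex.exp (z * (t : ℝ))) (Complex.exp_ne_zero _)
  have hu : T.rescale z t = u⁻¹ • T t := by
    rw [rescale_apply, neg_mul, Complex.exp_neg]
    rfl
  have hres : (u : ℂ) • resolvent (T t) (u : ℂ) = resolvent (T.rescale z t) (1 : ℂ) := by
    rw [hu]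
    exact spectrum.units_smul_resolvent_self (r := u)
  have hmem : 1 ∈ resolventSet ℂ (T.rescale z t) := by
    rw [spectrum.isUnit_resolvent (R := ℂ), ← hres]
    exact (isUnit_smul_iff u _).2 (spectrum.isUnit_resolvent.1 hz)
  have hinv := (T.rescale z).isInverseSub_generator_zero_of_one_mem hmem
  rwa [isInverseSub_generator_rescale_iff, zero_add, ← hres] at hinv

theorem exists_isInverseSub_generator_norm_le (T : C0Semigroup X) {t : ℝ≥0} {a : ℝ}
    (ha : Disjoint (spectrum ℂ (T t)) (Metric.sphere 0 (Real.exp (a * t)))) :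
    ∃ K, ∀ z : ℂ, z.re = a → ∃ R, IsInverseSub T.generator z R ∧ ‖R‖ ≤ K := by
  obtain ⟨M, hM⟩ := (T.rescale a).exists_norm_le t
  have hsphere : Metric.sphere 0 (Real.exp (a * t)) ⊆ resolventSet ℂ (T t) := fun w hw =>
    spectrum.notMem_iff.1 (disjoint_right.1 ha hw)
  obtain ⟨C, hC⟩ := exists_norm_resolvent_le (isCompact_sphere _ _) hsphere
  refine ⟨M * t * (Real.exp (a * t) * C), fun z hz => ?_⟩
  have hnorm : ‖Complex.exp (z * (t : ℝ))‖ = Real.exp (a * t) := by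
    rw [Complex.norm_exp, Complex.re_mul_ofReal, hz]
  have hmem := mem_sphere_zero_iff_norm.2 hnorm
  have hMz : ∀ s ≤ t, ‖T.rescale z s‖ ≤ M := fun s hs => by
    simpa only [norm_rescale_apply, hz, Complex.ofReal_re] using hM s hs
  refine ⟨_, T.isInverseSub_generator_of_exp_mem (hsphere hmem), ?_⟩
  rw [norm_neg]
  refine norm_mul_le_of_le ((T.rescale z).norm_integratedSemigroup_le hMz) ?_
  rw [norm_smul, hnorm]
  gcongr
  exact hC _ hmem

end C0Semigroup

theorem corollary3p1_general {X : Type*} [NormedAddCommGroup X] [NormedSpace ℂ X] [CompleteSpace X]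
    (T : C0Semigroup X) {t : ℝ≥0} {a : ℝ}
    (ha : Disjoint (spectrum ℂ (T t)) (Metric.sphere 0 (Real.exp (a * t)))) :
    {z : ℂ | z.re = a} ⊆ UnboundedOperator.resolventSet T.generator ∧
      BddAbove ((fun z : ℂ => ‖UnboundedOperator.resolvent T.generator z‖) ''
        {z : ℂ | z.re = a}) := by
  obtain ⟨K, hK⟩ := T.exists_isInverseSub_generator_norm_le ha
  refine ⟨fun z hz => ?_, K, ?_⟩
  · obtain ⟨R, hR, -⟩ := hK z hz
    exact ⟨R, hR⟩
  · rintro _ ⟨z, hz, rfl⟩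
    obtain ⟨R, hR, hRK⟩ := hK z hz
    simpa only [hR.resolvent_eq] using hRK

theorem corollary3p1 {X : Type*} [NormedAddCommGroup X] [NormedSpace ℂ X] [CompleteSpace X]
    (T : C0Semigroup X) (hT : T.IsHyperbolic) :
    {z : ℂ | z.re = 0} ⊆ UnboundedOperator.resolventSet T.generator ∧
      BddAbove ((fun z : ℂ => ‖UnboundedOperator.resolvent T.generator z‖) ''
        {z : ℂ | z.re = 0}) :=
  corollary3p1_general T (t := 1) (a := 0) <| by
    simpa [disjoint_iff_inter_eq_empty, Metric.sphere, C0Semigroup.IsHyperbolic] using hT
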